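/- Let $n \ge 4$. In the biased clique game $\mathrm{Clique}_{(1,3)}(n)$, two players, Alice (first player) and Bob (second player), alternately colour previously uncoloured edges of the complete graph $K_n$, with Alice starting. In each of her turns Alice colours $1$ edge red, and in each of his turns Bob colours $3$ edges blue (or all remaining uncoloured edges, if fewer than $3$ are left). The game ends when all edges are coloured. Let $A$ and $B$ be the final sets of red and blue edges, and let $a=\omega(G[A])$ and $b=\omega(G[B])$ be the clique numbers of the red and the blue graph. Bob wins if $b>a$. Then, for every $n\ge 4$, the game $\mathrm{Clique}_{(1,3)}(n)$ is won by the second player: Bob has a strategy which guarantees $b>a$ at the end of the game, however Alice plays. -/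

import Mathlib

namespace CliqueGame

variable {V : Type*} [DecidableEq V]

/-- A position of the game: the edges coloured red (by Alice) and blue (by Bob) so far. -/
structure Position (V : Type*) where
  red : Finset (Sym2 V)
  blue : Finset (Sym2 V)

/-- No edge is coloured at the start. -/
def Position.start (V : Type*) : Position V := ⟨∅, ∅⟩

/-- The edges of the board `G` that are not yet coloured. -/
def Position.uncoloured (G : SimpleGraph V) [Fintype G.edgeSet] (P : Position V) :
    Finset (Sym2 V) :=
  G.edgeFinset \ (P.red ∪ P.blue)

/-- Alice colours the edges in `S`. -/
def Position.addRed (P : Position V) (S : Finset (Sym2 V)) : Position V := ⟨P.red ∪ S, P.blue⟩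

/-- Bob colours the edges in `T`. -/
def Position.addBlue (P : Position V) (T : Finset (Sym2 V)) : Position V := ⟨P.red, P.blue ∪ T⟩

/-- `S` is a legal choice for a player who colours `k` edges per turn: exactly `k` uncoloured
edges, or all of them if fewer than `k` are left. -/
def Position.IsMove (G : SimpleGraph V) [Fintype G.edgeSet] (P : Position V) (k : ℕ)
    (S : Finset (Sym2 V)) : Prop :=
  S ⊆ P.uncoloured G ∧ S.card = min k (P.uncoloured G).card

/-- The game is over when every edge of the board is coloured. -/
def Position.IsOver (G : SimpleGraph V) [Fintype G.edgeSet] (P : Position V) : Prop :=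
  P.uncoloured G = ∅

/-- Alice's result: the clique number of the red graph. -/
noncomputable def Position.scoreAlice (P : Position V) : ℕ :=
  (SimpleGraph.fromEdgeSet (P.red : Set (Sym2 V))).cliqueNum

/-- Bob's result: the clique number of the blue graph. -/
noncomputable def Position.scoreBob (P : Position V) : ℕ :=
  (SimpleGraph.fromEdgeSet (P.blue : Set (Sym2 V))).cliqueNum

/-- A strategy of Bob: in each position in which he is to move, the set of edges he colours. -/
abbrev Strategy (V : Type*) := Position V → Finset (Sym2 V)

/-- The positions with Alice to move (or with the game over) that can arise when Alice, who starts
and colours `p` edges per turn, plays arbitrary legal moves and Bob answers by `σ`. -/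
inductive Reachable (G : SimpleGraph V) [Fintype G.edgeSet] (p : ℕ) (σ : Strategy V) :
    Position V → Prop
  | start : Reachable G p σ (Position.start V)
  | round (P : Position V) (S : Finset (Sym2 V)) :
      Reachable G p σ P → ¬ P.IsOver G → P.IsMove G p S →
      Reachable G p σ ((P.addRed S).addBlue (σ (P.addRed S)))

/-- `σ` is a winning strategy for Bob in the `(p, q)`-biased clique game on `G`, where
`1 ≤ p < q`: his answers are always legal, and whenever the game is over his largest clique is
strictly larger than Alice's. (As `1 ≤ p`, at least one edge is coloured in each round, so
every play ends.) -/
structure IsWinningForBob (G : SimpleGraph V) [Fintype G.edgeSet] (p q : ℕ) (σ : Strategy V) :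
    Prop where
  legal : ∀ (P : Position V) (S : Finset (Sym2 V)), Reachable G p σ P → ¬ P.IsOver G →
    P.IsMove G p S → (P.addRed S).IsMove G q (σ (P.addRed S))
  wins : ∀ P : Position V, Reachable G p σ P → P.IsOver G → P.scoreAlice < P.scoreBob

/-- The `(p, q)`-biased clique game on `G` (with `1 ≤ p < q`) is won by the second player. -/
def WonByBob (G : SimpleGraph V) [Fintype G.edgeSet] (p q : ℕ) : Prop :=
  ∃ σ : Strategy V, IsWinningForBob G p q σ

end CliqueGame

/-! Bob plays by forced replies. Fix a symmetric relation on edges with at most three relatives per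
edge; whenever Alice takes an edge, Bob takes its relatives. By symmetry none of them can already be
red, so no two related edges both end up red.

The vertices outside a small core come in pairs, and the core is placed so that Alice's first edge
is a prescribed core edge. Of the four edges between two pairs at most one is red. Hence replacing
each outside vertex of a red clique by its partner gives a blue clique of the same size. The extra
vertex comes from the core: the red part `D` there is exchanged for a blue clique `D'` with one
vertex more, all linked to `D`, so that `D'` is blue to the partners. If `D` is empty, the extra
vertex is an outside vertex of the clique whose pair edge is blue, or else the apex. A red clique
containing a whole pair has just two vertices and loses to a blue triangle in the core.

It remains to exhibit cores with 4 and 5 vertices, one for each parity of `n`. -/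

namespace CliqueGame

/-! ### Forced replies -/

/-- A table of forced replies on the board `G`: a symmetric irreflexive relation between edges, in
which every edge is related to at most `q` others. When Alice takes `e`, Bob takes `N e`. -/
structure IsReplyTable {V : Type*} (G : SimpleGraph V) (q : ℕ) (N : Sym2 V → Finset (Sym2 V)) : Prop where
  mem_edgeSet : ∀ e ∈ G.edgeSet, ∀ f ∈ N e, f ∈ G.edgeSet
  card_le : ∀ e ∈ G.edgeSet, (N e).card ≤ q
  irrefl : ∀ e ∈ G.edgeSet, e ∉ N e
  symm : ∀ e ∈ G.edgeSet, ∀ f ∈ N e, e ∈ N f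

/-- Bob has given all the forced replies to the red edges. -/
structure Position.Follows {V : Type*} (G : SimpleGraph V) (N : Sym2 V → Finset (Sym2 V)) (P : Position V) :
    Prop where
  red_subset : ∀ e ∈ P.red, e ∈ G.edgeSet
  disjoint : Disjoint P.red P.blue
  reply : ∀ e ∈ P.red, N e ⊆ P.blue

theorem Position.follows_start {V : Type*} (G : SimpleGraph V) (N : Sym2 V → Finset (Sym2 V)) :
    (Position.start V).Follows G N :=
  ⟨by simp [Position.start], by simp [Position.start], by simp [Position.start]⟩

section Forcing

variable {V : Type*} [DecidableEq V]

theorem Position.mem_uncoloured {G : SimpleGraph V} [Fintype G.edgeSet] {P : Position V}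
    {e : Sym2 V} : e ∈ P.uncoloured G ↔ e ∈ G.edgeSet ∧ e ∉ P.red ∧ e ∉ P.blue := by
  simp [Position.uncoloured]

/-- Bob can always give the forced replies. -/
theorem Position.Follows.exists_reply {G : SimpleGraph V} [Fintype G.edgeSet] {q : ℕ}
    {N : Sym2 V → Finset (Sym2 V)} (hN : IsReplyTable G q N) {P : Position V}
    (hP : P.Follows G N) {e : Sym2 V} (he : e ∈ P.uncoloured G) :
    ∃ T, (P.addRed {e}).IsMove G q T ∧ ((P.addRed {e}).addBlue T).Follows G N := by
  obtain ⟨heG, her, heb⟩ := Position.mem_uncoloured.1 he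
  have key : ∀ f ∈ N e, f ∉ P.blue → f ∈ (P.addRed {e}).uncoloured G := by
    intro f hf hfb
    refine Position.mem_uncoloured.2 ⟨hN.mem_edgeSet e heG f hf, ?_, hfb⟩
    intro h
    rcases Finset.mem_union.1 h with h | h
    -- Were `f` red, then `e`, a reply to `f` by symmetry, would already be blue.
    · exact heb (hP.reply f h (hN.symm e heG f hf))
    · rw [Finset.mem_singleton] at h
      exact hN.irrefl e heG (h ▸ hf)
  have hsub : N e \ P.blue ⊆ (P.addRed {e}).uncoloured G := by
    intro f hf
    rw [Finset.mem_sdiff] at hf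
    exact key f hf.1 hf.2
  have hcard : (N e \ P.blue).card ≤ min q ((P.addRed {e}).uncoloured G).card :=
    le_min ((Finset.card_le_card Finset.sdiff_subset).trans (hN.card_le e heG))
      (Finset.card_le_card hsub)
  -- A legal move has an exact size, so the forced replies are padded with arbitrary uncoloured
  -- edges.
  obtain ⟨T, hNT, hT, hTc⟩ := Finset.exists_subsuperset_card_eq hsub hcard (min_le_right _ _)
  refine ⟨T, ⟨hT, hTc⟩, ?_, ?_, ?_⟩
  · intro f hf
    rcases Finset.mem_union.1 hf with h | h
    · exact hP.red_subset f h
    · rw [Finset.mem_singleton] at h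
      exact h ▸ heG
  · refine Finset.disjoint_union_right.2 ⟨?_, ?_⟩
    · exact Finset.disjoint_union_left.2 ⟨hP.disjoint, Finset.disjoint_singleton_left.2 heb⟩
    · rw [Finset.disjoint_right]
      intro f hf
      exact (Position.mem_uncoloured.1 (hT hf)).2.1
  · intro f hf
    rcases Finset.mem_union.1 hf with h | h
    · exact (hP.reply f h).trans Finset.subset_union_left
    · rw [Finset.mem_singleton] at h
      subst h
      intro g hg
      by_cases hgb : g ∈ P.blue
      · exact Finset.mem_union_left _ hgb
      · exact Finset.mem_union_right _ (hNT (Finset.mem_sdiff.2 ⟨hg, hgb⟩))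

/-- If for each first edge `e` of Alice there is a table of replies by which Bob wins all plays
in which `e` is red, then Bob wins. -/
theorem wonByBob_of_forall_exists_isReplyTable {G : SimpleGraph V} [Fintype G.edgeSet] {q : ℕ}
    (hG : G.edgeSet.Nonempty)
    (H : ∀ e ∈ G.edgeSet, ∃ N, IsReplyTable G q N ∧ ∀ P : Position V, P.Follows G N →
      e ∈ P.red → P.IsOver G → P.scoreAlice < P.scoreBob) :
    WonByBob G 1 q := by
  classical
  -- A strategy sees the position and not the history, so the invariant only asks for some table.
  -- The witness may change from round to round; any one suffices at the end.
  let Good : Position V → Prop := fun P => P = Position.start V ∨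
    ∃ N, IsReplyTable G q N ∧ P.Follows G N ∧ ∃ e ∈ P.red,
      ∀ Q : Position V, Q.Follows G N → e ∈ Q.red → Q.IsOver G → Q.scoreAlice < Q.scoreBob
  have step : ∀ (P : Position V) (S : Finset (Sym2 V)), Good P → ¬ P.IsOver G → P.IsMove G 1 S →
      ∃ T, (P.addRed S).IsMove G q T ∧ Good ((P.addRed S).addBlue T) := by
    intro P S hP hover hS
    have hpos : 1 ≤ (P.uncoloured G).card :=
      Finset.card_pos.2 (Finset.nonempty_iff_ne_empty.2 hover)
    obtain ⟨e, rfl⟩ := Finset.card_eq_one.1 (hS.2.trans (min_eq_left hpos))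
    have he : e ∈ P.uncoloured G := hS.1 (Finset.mem_singleton_self e)
    rcases hP with rfl | ⟨N, hN, hPN, e₀, he₀, hwin⟩
    · obtain ⟨N, hN, hwin⟩ := H e (Position.mem_uncoloured.1 he).1
      obtain ⟨T, hT, hT'⟩ := (Position.follows_start G N).exists_reply hN he
      exact ⟨T, hT, Or.inr ⟨N, hN, hT', e,
        Finset.mem_union_right _ (Finset.mem_singleton_self e), hwin⟩⟩
    · obtain ⟨T, hT, hT'⟩ := hPN.exists_reply hN he
      exact ⟨T, hT, Or.inr ⟨N, hN, hT', e₀, Finset.mem_union_left _ he₀, hwin⟩⟩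
  let σ : Strategy V := fun Q =>
    if h : ∃ T, Q.IsMove G q T ∧ Good (Q.addBlue T) then h.choose else ∅
  have hσ : ∀ Q : Position V, (∃ T, Q.IsMove G q T ∧ Good (Q.addBlue T)) →
      Q.IsMove G q (σ Q) ∧ Good (Q.addBlue (σ Q)) := by
    intro Q h
    simp only [σ, dif_pos h]
    exact h.choose_spec
  have hgood : ∀ P, Reachable G 1 σ P → Good P := by
    intro P hP
    induction hP with
    | start => exact Or.inl rfl
    | round P S _ hover hS ih => exact (hσ _ (step P S ih hover hS)).2
  refine ⟨σ, fun P S hP hover hS => (hσ _ (step P S (hgood P hP) hover hS)).1, ?_⟩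
  intro P hP hover
  rcases hgood P hP with rfl | ⟨N, _, hPN, e, he, hwin⟩
  · obtain ⟨e, he⟩ := hG
    have : e ∈ (Position.start V).uncoloured G :=
      Position.mem_uncoloured.2 ⟨he, by simp [Position.start], by simp [Position.start]⟩
    rw [Position.IsOver] at hover
    rw [hover] at this
    simp at this
  · exact hwin P hPN he hover

end Forcing

/-! ### Cores and the tables they generate -/

/-- At the end of the game on a complete board, the blue graph is the complement of the red one. -/
theorem Position.fromEdgeSet_blue {V : Type*} [DecidableEq V]
    [Fintype (⊤ : SimpleGraph V).edgeSet] {P : Position V} (hd : Disjoint P.red P.blue)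
    (hover : P.IsOver (⊤ : SimpleGraph V)) :
    SimpleGraph.fromEdgeSet (P.blue : Set (Sym2 V)) =
      (SimpleGraph.fromEdgeSet (P.red : Set (Sym2 V)))ᶜ := by
  ext a b
  simp only [SimpleGraph.fromEdgeSet_adj, SimpleGraph.compl_adj, Finset.mem_coe]
  constructor
  · rintro ⟨hb, hne⟩
    exact ⟨hne, fun h => Finset.disjoint_left.1 hd h.1 hb⟩
  · rintro ⟨hne, hr⟩
    refine ⟨?_, hne⟩
    by_contra hb
    have : s(a, b) ∈ P.uncoloured (⊤ : SimpleGraph V) :=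
      Position.mem_uncoloured.2 ⟨by simpa using hne, fun h => hr ⟨h, hne⟩, hb⟩
    rw [Position.IsOver] at hover
    rw [hover] at this
    simp at this

/-- The red graph `G` respects the table of replies `N`. -/
def Respects {W : Type*} (N : Sym2 W → Finset (Sym2 W)) (G : SimpleGraph W) : Prop :=
  ∀ e ∈ G.edgeSet, ∀ f ∈ N e, f ∉ G.edgeSet

/-- A core: the part of the board on which Bob does not pair vertices. Outside it the vertices come
in pairs `u, v`, and Bob answers `su` by the edges `tv` with `t ∈ link s`. The edge `uv` is
answered by the two edges from the apex, and edges within the core by the table `inner`. -/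
structure Core (S : Type*) [DecidableEq S] where
  link : S → Finset S
  apex : S
  inner : Sym2 S → Finset (Sym2 S)
  fst : S
  snd : S
  fst_ne_snd : fst ≠ snd
  link_symm : ∀ s t, t ∈ link s → s ∈ link t
  -- At the apex, one of the three replies is spent on the pair edge.
  link_card : ∀ s, (link s).card + (if s = apex then 1 else 0) ≤ 3
  -- Prevents a red clique from containing a pair together with a core vertex; for the apex the
  -- reply to the pair edge does this.
  link_self : ∀ s, s ≠ apex → s ∈ link s
  inner_isReplyTable : IsReplyTable (⊤ : SimpleGraph S) 3 inner
  exists_compl_clique : ∀ G : SimpleGraph S, G.Adj fst snd → Respects inner G →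
    ∀ D : Finset S, D.Nonempty → G.IsClique D →
      ∃ D' : Finset S, Gᶜ.IsClique D' ∧ D'.card = D.card + 1 ∧ ∀ t ∈ D', ∃ s ∈ D, t ∈ link s

namespace Core

/-- The partner of a vertex outside the core. -/
def partner {ι : Type*} (u : ι × Bool) : ι × Bool := (u.1, !u.2)

theorem partner_injective {ι : Type*} : Function.Injective (partner : ι × Bool → ι × Bool) := by
  rintro ⟨i, b⟩ ⟨j, c⟩ h
  simpa [partner] using h

variable {S ι : Type*} [DecidableEq S] [DecidableEq ι] (K : Core S)

/-- The replies to an edge given by its two ends. -/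
def replyAux : S ⊕ (ι × Bool) → S ⊕ (ι × Bool) → Finset (Sym2 (S ⊕ (ι × Bool)))
  | .inl s, .inl t => (K.inner s(s, t)).image (Sym2.map Sum.inl)
  | .inl s, .inr (i, b) => (K.link s).image (fun t => s(.inl t, .inr (i, !b))) ∪
      if s = K.apex then {s(.inr (i, b), .inr (i, !b))} else ∅
  | .inr (i, b), .inl s => (K.link s).image (fun t => s(.inl t, .inr (i, !b))) ∪
      if s = K.apex then {s(.inr (i, b), .inr (i, !b))} else ∅
  | .inr (i, b), .inr (j, c) =>
      if i = j then {s(.inl K.apex, .inr (i, true)), s(.inl K.apex, .inr (i, false))}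
      else {s(.inr (i, b), .inr (j, !c)), s(.inr (i, !b), .inr (j, c)),
        s(.inr (i, !b), .inr (j, !c))}

theorem replyAux_comm (x y : S ⊕ (ι × Bool)) : K.replyAux x y = K.replyAux y x := by
  rcases x with s | ⟨i, b⟩ <;> rcases y with t | ⟨j, c⟩
  · simp only [replyAux, Sym2.eq_swap]
  · rfl
  · rfl
  · by_cases h : i = j
    · subst h
      simp [replyAux]
    · simp only [replyAux, if_neg h, if_neg (Ne.symm h)]
      ext e
      simp only [Finset.mem_insert, Finset.mem_singleton]
      rw [Sym2.eq_swap (a := Sum.inr (i, b)), Sym2.eq_swap (a := Sum.inr (i, !b)),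
        Sym2.eq_swap (a := Sum.inr (i, !b)) (b := Sum.inr (j, !c))]
      tauto

/-- The table of replies on the whole board. -/
def reply : Sym2 (S ⊕ (ι × Bool)) → Finset (Sym2 (S ⊕ (ι × Bool))) :=
  Sym2.lift ⟨K.replyAux, K.replyAux_comm⟩

theorem reply_mk (x y : S ⊕ (ι × Bool)) : K.reply s(x, y) = K.replyAux x y := rfl

theorem mem_reply_inl_inr {s : S} {i : ι} {b : Bool} {f : Sym2 (S ⊕ (ι × Bool))} :
    f ∈ K.reply s(.inl s, .inr (i, b)) ↔ (∃ t ∈ K.link s, s(.inl t, .inr (i, !b)) = f) ∨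
      (s = K.apex ∧ f = s(.inr (i, b), .inr (i, !b))) := by
  rw [reply_mk, replyAux]
  split_ifs with h <;> simp [h, or_comm]

theorem mem_reply_pair {i : ι} {b c : Bool} {f : Sym2 (S ⊕ (ι × Bool))} :
    f ∈ K.reply s(.inr (i, b), .inr (i, c)) ↔ ∃ d : Bool, f = s(.inl K.apex, .inr (i, d)) := by
  simp [reply_mk, replyAux, or_comm]

/-- The four edges between two pairs are mutually related, so at most one of them is red. -/
theorem mem_reply_inr_inr {i j : ι} (hij : i ≠ j) {b c : Bool} {f : Sym2 (S ⊕ (ι × Bool))} :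
    f ∈ K.reply s(.inr (i, b), .inr (j, c)) ↔
      ∃ b' c' : Bool, (b' ≠ b ∨ c' ≠ c) ∧ f = s(.inr (i, b'), .inr (j, c')) := by
  cases b <;> cases c <;> simp [reply_mk, replyAux, hij] <;> tauto

theorem mem_reply_inl_inl {s t : S} {f : Sym2 (S ⊕ (ι × Bool))} :
    f ∈ K.reply s(.inl s, .inl t) ↔ ∃ g ∈ K.inner s(s, t), Sym2.map Sum.inl g = f := by
  simp [reply_mk, replyAux]

theorem reply_isReplyTable :
    IsReplyTable (⊤ : SimpleGraph (S ⊕ (ι × Bool))) 3 K.reply := by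
  have hI := K.inner_isReplyTable
  have ind : ∀ p : Sym2 (S ⊕ (ι × Bool)) → Prop,
      (∀ s t, s ≠ t → p s(.inl s, .inl t)) → (∀ s i b, p s(.inl s, .inr (i, b))) →
      (∀ i b, p s(.inr (i, b), .inr (i, !b))) →
      (∀ i j b c, i ≠ j → p s(.inr (i, b), .inr (j, c))) →
      ∀ e ∈ (⊤ : SimpleGraph (S ⊕ (ι × Bool))).edgeSet, p e := by
    intro p h₁ h₂ h₃ h₄ e he
    induction e with | _ x y
    have hxy : x ≠ y := by simpa using he
    rcases x with s | ⟨i, b⟩ <;> rcases y with t | ⟨j, c⟩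
    · exact h₁ s t fun h => hxy (h ▸ rfl)
    · exact h₂ s j c
    · rw [Sym2.eq_swap]
      exact h₂ t i b
    · by_cases h : i = j
      · subst h
        obtain rfl : c = !b := by
          cases b <;> cases c <;> simp_all
        exact h₃ i b
      · exact h₄ i j b c h
  constructor
  · apply ind
    · intro s t hst f hf
      obtain ⟨g, hg, rfl⟩ := K.mem_reply_inl_inl.1 hf
      have := hI.mem_edgeSet s(s, t) (by simpa using hst) g hg
      induction g with | _ a b
      simpa using this
    · intro s i b f hf
      rcases K.mem_reply_inl_inr.1 hf with ⟨t, -, rfl⟩ | ⟨-, rfl⟩ <;> simp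
    · intro i b f hf
      obtain ⟨d, rfl⟩ := K.mem_reply_pair.1 hf
      simp
    · intro i j b c hij f hf
      obtain ⟨b', c', -, rfl⟩ := (K.mem_reply_inr_inr hij).1 hf
      simp [hij]
  · apply ind
    · intro s t hst
      exact Finset.card_image_le.trans (hI.card_le _ (by simpa using hst))
    · intro s i b
      refine (Finset.card_union_le _ _).trans (le_trans ?_ (K.link_card s))
      refine add_le_add Finset.card_image_le ?_
      split_ifs <;> simp
    · intro i b
      rw [reply_mk, replyAux, if_pos rfl]
      exact Finset.card_le_two.trans (by norm_num)
    · intro i j b c hij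
      rw [reply_mk, replyAux, if_neg hij]
      exact Finset.card_le_three
  · apply ind
    · intro s t hst hf
      obtain ⟨g, hg, h⟩ := K.mem_reply_inl_inl.1 hf
      rw [← Sym2.map_mk] at h
      obtain rfl := Sym2.map.injective Sum.inl_injective h
      exact hI.irrefl _ (by simpa using hst) hg
    · intro s i b hf
      simp [mem_reply_inl_inr] at hf
    · intro i b hf
      simp [mem_reply_pair] at hf
    · intro i j b c hij hf
      obtain ⟨b', c', h, hf⟩ := (K.mem_reply_inr_inr hij).1 hf
      simp only [Sym2.eq_iff, Sum.inr.injEq, Prod.mk.injEq] at hf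
      rcases hf with hf | hf
      · simp_all
      · exact hij hf.1.1
  · apply ind
    · intro s t hst f hf
      obtain ⟨g, hg, rfl⟩ := K.mem_reply_inl_inl.1 hf
      have := hI.symm s(s, t) (by simpa using hst) g hg
      induction g with | _ a b
      exact K.mem_reply_inl_inl.2 ⟨_, this, rfl⟩
    · intro s i b f hf
      rcases K.mem_reply_inl_inr.1 hf with ⟨t, ht, rfl⟩ | ⟨rfl, rfl⟩
      · exact K.mem_reply_inl_inr.2 (Or.inl ⟨s, K.link_symm s t ht, by simp⟩)
      · exact K.mem_reply_pair.2 ⟨b, rfl⟩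
    · intro i b f hf
      obtain ⟨d, rfl⟩ := K.mem_reply_pair.1 hf
      refine K.mem_reply_inl_inr.2 (Or.inr ⟨rfl, ?_⟩)
      cases b <;> cases d <;> simp
    · intro i j b c hij f hf
      obtain ⟨b', c', h, rfl⟩ := (K.mem_reply_inr_inr hij).1 hf
      exact (K.mem_reply_inr_inr hij).2 ⟨b, c, h.imp Ne.symm Ne.symm, rfl⟩

/-! ### Beating every red clique -/

/-- Red cliques are beaten by larger cliques of the complement. -/
theorem exists_larger_compl_clique {G : SimpleGraph (S ⊕ (ι × Bool))} (hG : Respects K.reply G)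
    (h₀ : G.Adj (.inl K.fst) (.inl K.snd)) {C : Finset (S ⊕ (ι × Bool))} (hC : G.IsClique C) :
    ∃ B : Finset (S ⊕ (ι × Bool)), Gᶜ.IsClique B ∧ B.card = C.card + 1 := by
  have hG' : ∀ {a b c d}, G.Adj a b → s(c, d) ∈ K.reply s(a, b) → ¬ G.Adj c d :=
    fun hab h => hG _ hab _ h
  have hlink : ∀ {s t : S} {i : ι} {b : Bool}, G.Adj (.inl s) (.inr (i, b)) → t ∈ K.link s →
      ¬ G.Adj (.inl t) (.inr (i, !b)) :=
    fun h ht => hG' h (K.mem_reply_inl_inr.2 (Or.inl ⟨_, ht, rfl⟩))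
  have hapex : ∀ {i : ι} {b c d : Bool}, G.Adj (.inr (i, b)) (.inr (i, c)) →
      ¬ G.Adj (.inl K.apex) (.inr (i, d)) :=
    fun h => hG' h (K.mem_reply_pair.2 ⟨_, rfl⟩)
  have hpair : ∀ {i j : ι} {b c b' c' : Bool}, i ≠ j → G.Adj (.inr (i, b)) (.inr (j, c)) →
      (b' ≠ b ∨ c' ≠ c) → ¬ G.Adj (.inr (i, b')) (.inr (j, c')) :=
    fun hij h hbc => hG' h ((K.mem_reply_inr_inr hij).2 ⟨_, _, hbc, rfl⟩)
  have hcore : ∀ D : Finset S, D.Nonempty → (∀ s ∈ D, ∀ t ∈ D, s ≠ t → G.Adj (.inl s) (.inl t)) →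
      ∃ D' : Finset S, (∀ s ∈ D', ∀ t ∈ D', s ≠ t → ¬ G.Adj (.inl s) (.inl t)) ∧
        D'.card = D.card + 1 ∧ ∀ t ∈ D', ∃ s ∈ D, t ∈ K.link s := by
    intro D hD hDc
    have hres : Respects K.inner (G.comap Sum.inl) := by
      intro e he f hf hfG
      induction e with | _ s t
      induction f with | _ s' t'
      exact hG' (a := .inl s) (b := .inl t) he (K.mem_reply_inl_inl.2 ⟨_, hf, rfl⟩) hfG
    obtain ⟨D', h₁, h₂⟩ := K.exists_compl_clique (G.comap Sum.inl) h₀ hres D hD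
      fun s hs t ht hst => hDc s hs t ht hst
    exact ⟨D', fun s hs t ht hst => (h₁ hs ht hst).2, h₂⟩
  by_cases hboth : ∃ i, Sum.inr (i, true) ∈ C ∧ Sum.inr (i, false) ∈ C
  · obtain ⟨i, ht, hf⟩ := hboth
    have hred : G.Adj (.inr (i, true)) (.inr (i, false)) := hC ht hf (by simp)
    have hmem : ∀ b, Sum.inr (i, b) ∈ C := by
      rintro (_ | _) <;> assumption
    have hsub : C ⊆ {.inr (i, true), .inr (i, false)} := by
      rintro (s | ⟨j, b⟩) hx
      · have hs : ∀ b, G.Adj (.inl s) (.inr (i, b)) := fun b => hC hx (hmem b) (by simp)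
        by_cases h : s = K.apex
        · subst h
          exact absurd (hs true) (hapex hred)
        · exact absurd (hs false) (hlink (hs true) (K.link_self s h))
      · by_cases hij : i = j
        · subst hij
          cases b <;> simp
        · exact absurd (hC (hmem false) hx (by simp [hij]))
            (hpair hij (hC (hmem true) hx (by simp [hij])) (by simp))
    have hCeq : C = {.inr (i, true), .inr (i, false)} :=
      hsub.antisymm (by
        intro x hx
        simp only [Finset.mem_insert, Finset.mem_singleton] at hx
        rcases hx with rfl | rfl <;> assumption)
    -- The red clique is a single pair; Alice's first edge, as a clique in the core, yields the blue
    -- triangle.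
    obtain ⟨D', h₁, h₂, -⟩ := hcore {K.fst, K.snd} (by simp) (by
      intro s hs t ht hst
      simp only [Finset.mem_insert, Finset.mem_singleton] at hs ht
      rcases hs with rfl | rfl <;> rcases ht with rfl | rfl
      · exact absurd rfl hst
      · exact h₀
      · exact h₀.symm
      · exact absurd rfl hst)
    refine ⟨D'.map ⟨Sum.inl, Sum.inl_injective⟩, ?_, ?_⟩
    · intro x hx y hy hxy
      simp only [Finset.coe_map, Function.Embedding.coeFn_mk, Set.mem_image,
        Finset.mem_coe] at hx hy
      obtain ⟨s, hs, rfl⟩ := hx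
      obtain ⟨t, ht, rfl⟩ := hy
      exact ⟨hxy, h₁ s hs t ht fun h => hxy (h ▸ rfl)⟩
    · rw [Finset.card_map, h₂, hCeq, Finset.card_pair K.fst_ne_snd, Finset.card_pair (by simp)]
  have hfst : ∀ {i : ι} {b c : Bool}, Sum.inr (i, b) ∈ C → Sum.inr (i, c) ∈ C → b = c := by
    intro i b c hb hc
    rcases b with _ | _ <;> rcases c with _ | _
    · rfl
    · exact absurd ⟨i, hc, hb⟩ hboth
    · exact absurd ⟨i, hb, hc⟩ hboth
    · rfl
  have hpart : ∀ {i j : ι} {b c : Bool}, Sum.inr (i, b) ∈ C → Sum.inr (j, c) ∈ C → i ≠ j →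
      ¬ G.Adj (.inr (i, !b)) (.inr (j, !c)) := fun hb hc hij =>
    hpair hij (hC hb hc (by simp [hij])) (by simp)
  -- It remains to find the part of the blue clique in the core.
  have hcombine : ∀ (D' : Finset S), D'.card = C.toLeft.card + 1 →
      (∀ s ∈ D', ∀ t ∈ D', s ≠ t → ¬ G.Adj (.inl s) (.inl t)) →
      (∀ t ∈ D', ∀ i b, Sum.inr (i, b) ∈ C → ¬ G.Adj (.inl t) (.inr (i, !b))) →
      ∃ B : Finset (S ⊕ (ι × Bool)), Gᶜ.IsClique B ∧ B.card = C.card + 1 := by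
    intro D' hcard h₁ h₂
    refine ⟨D'.disjSum (C.toRight.image partner), ?_, ?_⟩
    · rintro (s | ⟨i, b⟩) hx (t | ⟨j, c⟩) hy hxy <;>
        simp only [Finset.mem_coe, Finset.inl_mem_disjSum, Finset.inr_mem_disjSum,
          Finset.mem_image, Finset.mem_toRight] at hx hy
      · exact ⟨hxy, h₁ s hx t hy fun h => hxy (h ▸ rfl)⟩
      · obtain ⟨⟨j, c⟩, hy, h⟩ := hy
        obtain ⟨rfl, rfl⟩ := Prod.mk.inj h
        exact ⟨hxy, h₂ s hx _ _ hy⟩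
      · obtain ⟨⟨i, b⟩, hx, h⟩ := hx
        obtain ⟨rfl, rfl⟩ := Prod.mk.inj h
        exact ⟨hxy, fun h => h₂ t hy _ _ hx h.symm⟩
      · obtain ⟨⟨i, b⟩, hx, h⟩ := hx
        obtain ⟨rfl, rfl⟩ := Prod.mk.inj h
        obtain ⟨⟨j, c⟩, hy, h⟩ := hy
        obtain ⟨rfl, rfl⟩ := Prod.mk.inj h
        refine ⟨hxy, hpart hx hy ?_⟩
        rintro rfl
        obtain rfl := hfst hx hy
        exact hxy rfl
    · rw [Finset.card_disjSum, Finset.card_image_of_injective _ partner_injective, hcard,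
        ← Finset.card_toLeft_add_card_toRight (u := C)]
      omega
  by_cases hD : C.toLeft.Nonempty
  · obtain ⟨D', h₁, h₂, h₃⟩ := hcore C.toLeft hD (by
      intro s hs t ht hst
      exact hC (Finset.mem_toLeft.1 hs) (Finset.mem_toLeft.1 ht) (by simpa using hst))
    refine hcombine D' h₂ h₁ ?_
    intro t ht i b hib
    obtain ⟨s, hs, hst⟩ := h₃ t ht
    exact hlink (hC (Finset.mem_toLeft.1 hs) hib (by simp)) hst
  rw [Finset.not_nonempty_iff_eq_empty] at hD
  by_cases hblue : ∃ i b, Sum.inr (i, b) ∈ C ∧ ¬ G.Adj (.inr (i, b)) (.inr (i, !b))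
  -- The vertex `(i, b)` joins the partners: it is blue to its own partner, and its edge to any
  -- other partner is a reply to a red edge of `C`.
  · obtain ⟨i, b, hib, hnadj⟩ := hblue
    have hins : ∀ x ∈ C.toRight.image partner, (Sum.inr (i, b) : S ⊕ (ι × Bool)) ≠ .inr x ∧
        ¬ G.Adj (.inr (i, b)) (.inr x) := by
      intro x hx
      obtain ⟨⟨j, c⟩, hy, rfl⟩ := Finset.mem_image.1 hx
      rw [Finset.mem_toRight] at hy
      by_cases hij : i = j
      · subst hij
        obtain rfl := hfst hib hy
        exact ⟨by simp [partner], hnadj⟩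
      · exact ⟨by simp [partner, hij], hpair hij (hC hib hy (by simp [hij])) (by simp)⟩
    have hnot : (Sum.inr (i, b) : S ⊕ (ι × Bool)) ∉
        (C.toRight.image partner).map ⟨Sum.inr, Sum.inr_injective⟩ := by
      intro h
      obtain ⟨x, hx, h⟩ := Finset.mem_map.1 h
      exact (hins x hx).1 h.symm
    refine ⟨insert (.inr (i, b)) ((C.toRight.image partner).map ⟨Sum.inr, Sum.inr_injective⟩),
      ?_, ?_⟩
    · rw [Finset.coe_insert]
      refine SimpleGraph.IsClique.insert ?_ ?_
      · intro x hx y hy hxy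
        rw [Finset.mem_coe, Finset.mem_map] at hx hy
        obtain ⟨x, hx, rfl⟩ := hx
        obtain ⟨y, hy, rfl⟩ := hy
        obtain ⟨⟨j, c⟩, hj, rfl⟩ := Finset.mem_image.1 hx
        obtain ⟨⟨k, d⟩, hk, rfl⟩ := Finset.mem_image.1 hy
        rw [Finset.mem_toRight] at hj hk
        refine ⟨hxy, hpart hj hk ?_⟩
        rintro rfl
        obtain rfl := hfst hj hk
        exact hxy rfl
      · intro x hx _
        rw [Finset.mem_coe, Finset.mem_map] at hx
        obtain ⟨x, hx, rfl⟩ := hx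
        exact hins x hx
    · rw [Finset.card_insert_of_notMem hnot, Finset.card_map,
        Finset.card_image_of_injective _ partner_injective,
        ← Finset.card_toLeft_add_card_toRight (u := C), hD]
      simp
  · push Not at hblue
    -- All pair edges at `C` are red, so their replies make the apex blue to every partner.
    refine hcombine {K.apex} (by simp [hD]) (by simp) ?_
    intro t ht i b hib
    rw [Finset.mem_singleton] at ht
    subst ht
    exact hapex (hblue i b hib)

end Core

/-! ### Placing the core on Alice's first edge -/

/-- Two given vertices can be moved to two given places. -/
theorem exists_equiv_apply_eq {V W : Type*} [DecidableEq W] (φ : V ≃ W) {a b : V} (hab : a ≠ b)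
    {x y : W} (hxy : x ≠ y) : ∃ ψ : V ≃ W, ψ a = x ∧ ψ b = y := by
  let φ₁ := φ.trans (Equiv.swap (φ a) x)
  have h₁ : φ₁ a = x := by simp [φ₁]
  have h₂ : φ₁ b ≠ x := fun h => hab (φ₁.injective (h₁.trans h.symm))
  refine ⟨φ₁.trans (Equiv.swap (φ₁ b) y), ?_, by simp⟩
  rw [Equiv.trans_apply, h₁, Equiv.swap_apply_of_ne_of_ne h₂.symm hxy]

theorem IsReplyTable.comap {V W : Type*} [DecidableEq V] {q : ℕ}
    {N : Sym2 W → Finset (Sym2 W)} (hN : IsReplyTable (⊤ : SimpleGraph W) q N) (φ : V ≃ W) :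
    IsReplyTable (⊤ : SimpleGraph V) q
      (fun e => (N (e.map φ)).image (Sym2.map φ.symm)) := by
  have hmap : ∀ f : Sym2 W, (f.map φ.symm).map φ = f := by
    intro f
    induction f with | _ a b
    simp
  have hmap' : ∀ f : Sym2 V, (f.map φ).map φ.symm = f := by
    intro f
    induction f with | _ a b
    simp
  have hedge : ∀ e : Sym2 V, e.map φ ∈ (⊤ : SimpleGraph W).edgeSet ↔
      e ∈ (⊤ : SimpleGraph V).edgeSet := by
    intro e
    induction e with | _ a b
    simp
  have hmem : ∀ e f : Sym2 V, f ∈ (N (e.map φ)).image (Sym2.map φ.symm) ↔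
      f.map φ ∈ N (e.map φ) := by
    intro e f
    rw [Finset.mem_image]
    constructor
    · rintro ⟨g, hg, rfl⟩
      rwa [hmap]
    · intro h
      exact ⟨_, h, hmap' f⟩
  refine ⟨?_, ?_, ?_, ?_⟩
  · intro e he f hf
    exact (hedge f).1 (hN.mem_edgeSet _ ((hedge e).2 he) _ ((hmem e f).1 hf))
  · intro e he
    exact Finset.card_image_le.trans (hN.card_le _ ((hedge e).2 he))
  · intro e he hf
    exact hN.irrefl _ ((hedge e).2 he) ((hmem e e).1 hf)
  · intro e he f hf
    exact (hmem f e).2 (hN.symm _ ((hedge e).2 he) _ ((hmem e f).1 hf))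

/-- Bob wins on every complete board that consists of a core and of pairs of vertices. -/
theorem Core.wonByBob {S ι V : Type*} [DecidableEq S] [DecidableEq ι] [DecidableEq V] [Finite V]
    [Fintype (⊤ : SimpleGraph V).edgeSet] (K : Core S) (φ₀ : V ≃ S ⊕ (ι × Bool)) :
    WonByBob (⊤ : SimpleGraph V) 1 3 := by
  have h01 : (Sum.inl K.fst : S ⊕ (ι × Bool)) ≠ .inl K.snd := by simpa using K.fst_ne_snd
  apply wonByBob_of_forall_exists_isReplyTable
  · exact ⟨s(φ₀.symm (.inl K.fst), φ₀.symm (.inl K.snd)), by simpa using K.fst_ne_snd⟩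
  intro e he
  induction e with | _ a b
  obtain ⟨φ, ha, hb⟩ := exists_equiv_apply_eq φ₀ (show a ≠ b by simpa using he) h01
  refine ⟨_, K.reply_isReplyTable.comap φ, ?_⟩
  intro P hP hab hover
  rw [Position.scoreAlice, Position.scoreBob, Position.fromEdgeSet_blue hP.disjoint hover]
  set G := SimpleGraph.fromEdgeSet (P.red : Set (Sym2 V)) with hGdef
  obtain ⟨C, hC⟩ := G.exists_isNClique_cliqueNum
  have hres : Respects K.reply (G.comap φ.symm) := by
    intro e he f hf hfG
    induction e with | _ x y
    induction f with | _ z w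
    have h₁ : s(φ.symm x, φ.symm y) ∈ P.red :=
      (SimpleGraph.fromEdgeSet_adj _ |>.1 he).1
    have h₂ : s(φ.symm z, φ.symm w) ∈ P.red :=
      (SimpleGraph.fromEdgeSet_adj _ |>.1 hfG).1
    refine Finset.disjoint_left.1 hP.disjoint h₂ (hP.reply _ h₁ ?_)
    exact Finset.mem_image.2 ⟨s(z, w), by simpa using hf, rfl⟩
  obtain ⟨B, hB, hBc⟩ := K.exists_larger_compl_clique hres
    (C := C.map φ.toEmbedding) (by
      rw [SimpleGraph.comap_adj, ← ha, ← hb, Equiv.symm_apply_apply, Equiv.symm_apply_apply]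
      exact (SimpleGraph.fromEdgeSet_adj _).2 ⟨hab, by simpa using he⟩) (by
      intro x hx y hy hxy
      rw [Finset.mem_coe, Finset.mem_map] at hx hy
      obtain ⟨x, hx, rfl⟩ := hx
      obtain ⟨y, hy, rfl⟩ := hy
      simpa using hC.isClique hx hy fun h => hxy (h ▸ rfl))
  have hB' : Gᶜ.IsClique (B.map φ.symm.toEmbedding : Finset V) := by
    intro x hx y hy hxy
    rw [Finset.mem_coe, Finset.mem_map] at hx hy
    obtain ⟨x, hx, rfl⟩ := hx
    obtain ⟨y, hy, rfl⟩ := hy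
    exact ⟨hxy, (hB hx hy fun h => hxy (h ▸ rfl)).2⟩
  have hle := hB'.card_le_cliqueNum
  rw [Finset.card_map, hBc, Finset.card_map, hC.card_eq] at hle
  exact hle

/-! ### The two cores -/

/-- The symmetric table of replies given by a list of pairs of edges. -/
def tableOfList {S : Type*} [Fintype S] [DecidableEq S] (L : List (Sym2 S × Sym2 S))
    (e : Sym2 S) : Finset (Sym2 S) :=
  Finset.univ.filter fun f => (e, f) ∈ L ∨ (f, e) ∈ L

theorem Respects.not_adj {S : Type*} [Fintype S] [DecidableEq S] {L : List (Sym2 S × Sym2 S)}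
    {G : SimpleGraph S} (hG : Respects (tableOfList L) G) {a b c d : S}
    (hL : (s(a, b), s(c, d)) ∈ L) (hab : G.Adj a b) : ¬ G.Adj c d :=
  hG s(a, b) hab s(c, d) (by simp [tableOfList, hL])

theorem isReplyTable_of_forall {S : Type*} [DecidableEq S] {q : ℕ}
    {N : Sym2 S → Finset (Sym2 S)}
    (h : ∀ e : Sym2 S, (∀ f ∈ N e, ¬ f.IsDiag ∧ e ∈ N f) ∧ (N e).card ≤ q ∧ e ∉ N e) :
    IsReplyTable (⊤ : SimpleGraph S) q N := by
  refine ⟨fun e _ f hf => ?_, fun e _ => (h e).2.1, fun e _ => (h e).2.2,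
    fun e _ f hf => ((h e).1 f hf).2⟩
  have := ((h e).1 f hf).1
  induction f with | _ a b
  simpa using this

/-- A criterion for the condition on the cliques within a core if the red graph on the core has no
triangle. -/
theorem exists_compl_clique_of_triangleFree {S : Type*} [DecidableEq S] {G : SimpleGraph S}
    {link : S → Finset S} (hno : ∀ a b c, G.Adj a b → G.Adj a c → ¬ G.Adj b c)
    (hone : ∀ s, ∃ a b, Gᶜ.Adj a b ∧ {a, b} ⊆ link s)
    (htwo : ∀ s t, G.Adj s t → ∃ a b c, Gᶜ.Adj a b ∧ Gᶜ.Adj a c ∧ Gᶜ.Adj b c ∧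
      {a, b, c} ⊆ link s ∪ link t)
    {D : Finset S} (hD : D.Nonempty) (hDG : G.IsClique D) :
    ∃ D' : Finset S, Gᶜ.IsClique D' ∧ D'.card = D.card + 1 ∧ ∀ t ∈ D', ∃ s ∈ D, t ∈ link s := by
  have hle : D.card ≤ 2 := by
    by_contra! h
    obtain ⟨a, b, c, ha, hb, hc, hab, hac, hbc⟩ := Finset.two_lt_card_iff.1 h
    exact hno a b c (hDG ha hb hab) (hDG ha hc hac) (hDG hb hc hbc)
  have hpos := hD.card_pos
  obtain h | h : D.card = 1 ∨ D.card = 2 := by omega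
  · obtain ⟨s, rfl⟩ := Finset.card_eq_one.1 h
    obtain ⟨a, b, hab, hsub⟩ := hone s
    refine ⟨{a, b}, ?_, by rw [Finset.card_pair hab.ne, h], fun t ht => ⟨s, by simp, hsub ht⟩⟩
    rw [Finset.coe_pair, SimpleGraph.isClique_pair]
    exact fun _ => hab
  · obtain ⟨s, t, hst, rfl⟩ := Finset.card_eq_two.1 h
    obtain ⟨a, b, c, hab, hac, hbc, hsub⟩ :=
      htwo s t (hDG (Finset.mem_coe.2 (by simp)) (Finset.mem_coe.2 (by simp)) hst)
    have hcl := SimpleGraph.is3Clique_triple_iff.2 ⟨hab, hac, hbc⟩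
    refine ⟨{a, b, c}, hcl.isClique, by rw [hcl.card_eq, h], fun x hx => ?_⟩
    rcases Finset.mem_union.1 (hsub hx) with hx | hx
    · exact ⟨s, by simp, hx⟩
    · exact ⟨t, by simp, hx⟩

/-- The core for boards with an even number of vertices. -/
def coreFour : Core (Fin 4) where
  link := ![{0, 2, 3}, {2, 3}, {0, 1, 2}, {0, 1, 3}]
  apex := 1
  -- The replies to 01 make the triangle 0, 2, 3 blue, so red edges form a star at 1. The links of
  -- the ends of any such edge cover this triangle.
  inner := tableOfList [(s(0, 1), s(0, 2)), (s(0, 1), s(0, 3)), (s(0, 1), s(2, 3))]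
  fst := 0
  snd := 1
  fst_ne_snd := by decide
  link_symm := by decide
  link_card := by decide
  link_self := by decide
  inner_isReplyTable := isReplyTable_of_forall (by decide)
  exists_compl_clique := by
    intro G h01 hG D hD hDG
    have h02 : Gᶜ.Adj 0 2 := ⟨by decide, hG.not_adj (by simp) h01⟩
    have h03 : Gᶜ.Adj 0 3 := ⟨by decide, hG.not_adj (by simp) h01⟩
    have h23 : Gᶜ.Adj 2 3 := ⟨by decide, hG.not_adj (by simp) h01⟩
    have hadj : ∀ a b, G.Adj a b → a = 1 ∨ b = 1 := by
      have h₁ := h02.2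
      have h₂ := h03.2
      have h₃ := h23.2
      intro a b
      fin_cases a <;> fin_cases b <;> simp_all [G.adj_comm]
    refine exists_compl_clique_of_triangleFree ?_ ?_ ?_ hD hDG
    · intro a b c hab hac hbc
      have := hadj a b hab
      have := hadj a c hac
      have := hadj b c hbc
      have := hab.ne
      have := hac.ne
      have := hbc.ne
      grind
    · intro s
      fin_cases s
      · exact ⟨2, 3, h23, by decide⟩
      · exact ⟨2, 3, h23, by decide⟩
      · exact ⟨0, 2, h02, by decide⟩
      · exact ⟨0, 3, h03, by decide⟩
    · intro s t hst
      refine ⟨0, 2, 3, h02, h03, h23, ?_⟩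
      have := hadj s t hst
      have := hst.ne
      clear hst hDG hD
      revert s t
      decide

/-- The core for boards with an odd number of vertices. -/
def coreFive : Core (Fin 5) where
  link := ![{2, 3}, {1, 3, 4}, {0, 2, 4}, {0, 1, 3}, {1, 2, 4}]
  apex := 0
  -- The replies to 01 make the triangle 2, 3, 4 blue. The pairs 02–12, 03–13, 04–14 leave 0 and 1
  -- no common red neighbour, hence no red triangle. The links of a red edge cover 2, 3, 4 except
  -- for 03 and 13; there 03–12 and 13–04 supply the blue triangles 1, 2, 3 and 0, 3, 4.
  inner := tableOfList [(s(0, 1), s(2, 3)), (s(0, 1), s(2, 4)), (s(0, 1), s(3, 4)),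
    (s(0, 3), s(1, 3)), (s(0, 3), s(1, 2)), (s(1, 3), s(0, 4)), (s(0, 2), s(1, 2)),
    (s(0, 4), s(1, 4))]
  fst := 0
  snd := 1
  fst_ne_snd := by decide
  link_symm := by decide
  link_card := by decide
  link_self := by decide
  inner_isReplyTable := isReplyTable_of_forall (by decide)
  exists_compl_clique := by
    intro G h01 hG D hD hDG
    have h23 : Gᶜ.Adj 2 3 := ⟨by decide, hG.not_adj (by simp) h01⟩
    have h24 : Gᶜ.Adj 2 4 := ⟨by decide, hG.not_adj (by simp) h01⟩
    have h34 : Gᶜ.Adj 3 4 := ⟨by decide, hG.not_adj (by simp) h01⟩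
    have h03_13 : G.Adj 0 3 → ¬ G.Adj 1 3 := hG.not_adj (by simp)
    have h03_12 : G.Adj 0 3 → ¬ G.Adj 1 2 := hG.not_adj (by simp)
    have h13_04 : G.Adj 1 3 → ¬ G.Adj 0 4 := hG.not_adj (by simp)
    have h02_12 : G.Adj 0 2 → ¬ G.Adj 1 2 := hG.not_adj (by simp)
    have h04_14 : G.Adj 0 4 → ¬ G.Adj 1 4 := hG.not_adj (by simp)
    have hadj : ∀ a b, G.Adj a b → a < 2 ∨ b < 2 := by
      have h₁ := h23.2
      have h₂ := h24.2
      have h₃ := h34.2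
      intro a b
      fin_cases a <;> fin_cases b <;> simp_all [G.adj_comm]
    have hcommon : ∀ c, G.Adj 0 c → ¬ G.Adj 1 c := by
      intro c
      fin_cases c
      · simp
      · simp
      · exact h02_12
      · exact h03_13
      · exact h04_14
    refine exists_compl_clique_of_triangleFree ?_ ?_ ?_ hD hDG
    · have hthree : ∀ a b c : Fin 5, (a < 2 ∨ b < 2) → (a < 2 ∨ c < 2) → (b < 2 ∨ c < 2) →
          a ≠ b → a ≠ c → b ≠ c → (a = 0 ∧ b = 1) ∨ (a = 1 ∧ b = 0) ∨ (a = 0 ∧ c = 1) ∨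
            (a = 1 ∧ c = 0) ∨ (b = 0 ∧ c = 1) ∨ (b = 1 ∧ c = 0) := by decide
      intro a b c hab hac hbc
      rcases hthree a b c (hadj a b hab) (hadj a c hac) (hadj b c hbc) hab.ne hac.ne hbc.ne with
        ⟨rfl, rfl⟩ | ⟨rfl, rfl⟩ | ⟨rfl, rfl⟩ | ⟨rfl, rfl⟩ | ⟨rfl, rfl⟩ | ⟨rfl, rfl⟩
      · exact hcommon c hac hbc
      · exact hcommon c hbc hac
      · exact hcommon b hab hbc.symm
      · exact hcommon b hbc.symm hab
      · exact hcommon a hab.symm hac.symm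
      · exact hcommon a hac.symm hab.symm
    · intro s
      fin_cases s
      · exact ⟨2, 3, h23, by decide⟩
      · exact ⟨3, 4, h34, by decide⟩
      · exact ⟨2, 4, h24, by decide⟩
      -- The link of 3 misses 2 and 4, so the blue edge must be 03 or 13, which are not both red.
      · by_cases h : G.Adj 0 3
        · exact ⟨1, 3, ⟨by decide, h03_13 h⟩, by decide⟩
        · exact ⟨0, 3, ⟨by decide, h⟩, by decide⟩
      · exact ⟨2, 4, h24, by decide⟩
    · have hcases : ∀ s t : Fin 5, (s < 2 ∨ t < 2) → s ≠ t →
          ({2, 3, 4} : Finset (Fin 5)) ⊆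
            (![{2, 3}, {1, 3, 4}, {0, 2, 4}, {0, 1, 3}, {1, 2, 4}] : Fin 5 → Finset (Fin 5)) s ∪
            (![{2, 3}, {1, 3, 4}, {0, 2, 4}, {0, 1, 3}, {1, 2, 4}] : Fin 5 → Finset (Fin 5)) t ∨
          (s = 0 ∧ t = 3) ∨ (s = 3 ∧ t = 0) ∨ (s = 1 ∧ t = 3) ∨ (s = 3 ∧ t = 1) := by decide
      intro s t hst
      have h03 (h : G.Adj 0 3) : Gᶜ.Adj 1 2 ∧ Gᶜ.Adj 1 3 ∧ Gᶜ.Adj 2 3 :=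
        ⟨⟨by decide, h03_12 h⟩, ⟨by decide, h03_13 h⟩, h23⟩
      have h13 (h : G.Adj 1 3) : Gᶜ.Adj 0 3 ∧ Gᶜ.Adj 0 4 ∧ Gᶜ.Adj 3 4 :=
        ⟨⟨by decide, fun h' => h03_13 h' h⟩, ⟨by decide, h13_04 h⟩, h34⟩
      rcases hcases s t (hadj s t hst) hst.ne with
        h | ⟨rfl, rfl⟩ | ⟨rfl, rfl⟩ | ⟨rfl, rfl⟩ | ⟨rfl, rfl⟩
      · exact ⟨2, 3, 4, h23, h24, h34, h⟩
      · exact ⟨1, 2, 3, (h03 hst).1, (h03 hst).2.1, (h03 hst).2.2, by decide⟩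
      · exact ⟨1, 2, 3, (h03 hst.symm).1, (h03 hst.symm).2.1, (h03 hst.symm).2.2, by decide⟩
      · exact ⟨0, 3, 4, (h13 hst).1, (h13 hst).2.1, (h13 hst).2.2, by decide⟩
      · exact ⟨0, 3, 4, (h13 hst.symm).1, (h13 hst.symm).2.1, (h13 hst.symm).2.2, by decide⟩

end CliqueGame

theorem mainTheorem1 (n : ℕ) (hn : 4 ≤ n) :
    CliqueGame.WonByBob (⊤ : SimpleGraph (Fin n)) 1 3 := by
  rcases Nat.even_or_odd' n with ⟨m, rfl | rfl⟩
  · exact CliqueGame.coreFour.wonByBob (ι := Fin (m - 2)) (Fintype.equivOfCardEq (by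
      simp
      omega))
  · exact CliqueGame.coreFive.wonByBob (ι := Fin (m - 2)) (Fintype.equivOfCardEq (by
      simp
      omega))
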